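/- Let $(X,d)$ be a metric space with more than one point. Write $B(x,r)$ for open balls in $X$ and $|U|=\sup_{x,y\in U}d(x,y)$ for the diameter of $U\subseteq X$. Assume that $X$ is uniformly perfect: there is $c\in(0,1)$ such that $B(x,R)\setminus B(x,cR)\neq\varnothing$ for all $x\in X$ and $0<R<|X|$. Let $\Phi$ be a real-valued function that is admissible: there is $Y\in(0,\infty)$ such that $0<\Phi(\delta)\le\delta$ for all $\delta\in(0,Y)$, $\Phi$ is monotonic on $(0,Y)$, and $\Phi(\delta)/\delta\to0$ as $\delta\to0^+$. Let $F\subseteq X$ be non-empty and totally bounded, with finite Assouad dimension $$\dim_{\mathrm A}F=\inf\{\alpha:\exists\,C>0\ \forall x\in F\ \forall\,0<r<R,\ N_r(B(x,R)\cap F)\le C(R/r)^\alpha\}<\infty,$$ where $N_r(E)$ is the smallest number of open balls of $X$ of diameter at most $r$ that cover $E$. For $\delta>0$, call a finite or countable cover $\{U_i\}$ of $F$ by subsets of $X$ with $\Phi(\delta)\le|U_i|\le\delta$ for all $i$ a $(\Phi,\delta)$-cover. With $\inf\varnothing=\infty$, define $$\overline{\dim}^{\Phi}F=\inf\Big\{s\ge0:\forall\varepsilon>0\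 \exists\delta_0\in(0,1]\ \forall\delta\in(0,\delta_0)\ \text{there is a }(\Phi,\delta)\text{-cover }\{U_i\}\text{ with }\sum_i|U_i|^s\le\varepsilon\Big\},$$ $$\underline{\dim}^{\Phi}F=\inf\Big\{s\ge0:\forall\varepsilon>0\ \forall\delta_0\in(0,1]\ \exists\delta\in(0,\delta_0)\text{ and a }(\Phi,\delta)\text{-cover }\{U_i\}\text{ with }\sum_i|U_i|^s\le\varepsilon\Big\}.$$ Say that a Borel probability measure $\mu$ on $X$ is supported on $F$ if $\mu(\operatorname{supp}\mu)=1$ and $\operatorname{supp}\mu\subseteq F$, where $\operatorname{supp}\mu$ is the set of points all of whose neighbourhoods have positive $\mu$-measure. (The condition $\mu(\operatorname{supp}\mu)=1$ is automatic if $X$ is separable.) For $\delta,C>0$ and $s\ge0$ let $\mathcal M(\delta,C,s)$ be the set of Borel probability measures $\mu$ supported on $F$ such that $\mu(U)\le C|U|^s$ for every Borel set $U\subseteq X$ with $\Phi(\delta)\le|U|\le\delta$. Then $$\text{(i)}\quad\overline{\dim}^{\Phi}F=\sup\{s\ge0:\exists\,C\in(0,\infty)\ \forall\delta_1>0\ \exists\delta\in(0,\delta_1)\text{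 with }\mathcal M(\delta,C,s)\neq\varnothing\},$$ $$\text{(ii)}\quad\underline{\dim}^{\Phi}F=\sup\{s\ge0:\exists\,C,\delta_1\in(0,\infty)\ \forall\delta\in(0,\delta_1),\ \mathcal M(\delta,C,s)\neq\varnothing\}.$$ -/

import Mathlib

open Set Filter Topology MeasureTheory
open scoped NNReal ENNReal

/-- `Φ` is `Y`-admissible. Only the values of `Φ` on `(0, Y)` matter, so `Φ` is taken to be a
total function on `ℝ`. -/
structure IsAdmissibleOn (Y : ℝ) (Φ : ℝ → ℝ) : Prop where
  pos : ∀ δ ∈ Ioo 0 Y, 0 < Φ δ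
  le_self : ∀ δ ∈ Ioo 0 Y, Φ δ ≤ δ
  tendsto : Tendsto (fun δ => Φ δ / δ) (𝓝[>] 0) (𝓝 0)
  monotonic : MonotoneOn Φ (Ioo 0 Y) ∨ AntitoneOn Φ (Ioo 0 Y)

/-- `Φ` is admissible if it is `Y`-admissible for some `Y ∈ (0, ∞)`. -/
def IsAdmissible (Φ : ℝ → ℝ) : Prop :=
  ∃ Y : ℝ, 0 < Y ∧ IsAdmissibleOn Y Φ

/-- `X` is uniformly perfect: for some `c ∈ (0,1)`, `B(x, R) \ B(x, cR)` is non-empty for all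
`x ∈ X` and `0 < R < |X|`, where the diameter `|X|` may be infinite. -/
def IsUniformlyPerfect (X : Type*) [MetricSpace X] : Prop :=
  ∃ c ∈ Ioo (0 : ℝ) 1, ∀ (x : X) (R : ℝ), 0 < R →
    ENNReal.ofReal R < Metric.ediam (univ : Set X) →
      (Metric.ball x R \ Metric.ball x (c * R)).Nonempty

/-- `N_r(F)`: the smallest number of open balls of `X` of diameter at most `r` which cover `F`
(`⊤` if no finite number suffices). -/
noncomputable def ballCoveringNumber {X : Type*} [MetricSpace X] (r : ℝ) (F : Set X) : ℕ∞ :=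
  ⨅ (𝓑 : Set (Set X))
    (_ : (∀ B ∈ 𝓑, (∃ (x : X) (ρ : ℝ), 0 < ρ ∧ B = Metric.ball x ρ) ∧
        Metric.ediam B ≤ ENNReal.ofReal r) ∧
      F ⊆ ⋃₀ 𝓑), 𝓑.encard

/-- The Assouad dimension of `F`, with the convention `inf ∅ = ∞`. -/
noncomputable def assouadDim {X : Type*} [MetricSpace X] (F : Set X) : EReal :=
  ⨅ (α : ℝ) (_ : ∃ C : ℝ, 0 < C ∧ ∀ x ∈ F, ∀ r R : ℝ, 0 < r → r < R →
      (ballCoveringNumber r (Metric.ball x R ∩ F) : ℝ≥0∞) ≤ ENNReal.ofReal (C * (R / r) ^ α)),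
    (α : EReal)

/-- `𝓤` is a finite or countable cover of `F` by sets `U` with `Φ(δ) ≤ |U| ≤ δ`. The upper bound
on the extended diameter makes each `U` bounded. -/
structure IsScaleCover {X : Type*} [MetricSpace X] (Φ : ℝ → ℝ) (δ : ℝ) (F : Set X)
    (𝓤 : Set (Set X)) : Prop where
  countable : 𝓤.Countable
  covers : F ⊆ ⋃₀ 𝓤
  le_diam : ∀ U ∈ 𝓤, ENNReal.ofReal (Φ δ) ≤ Metric.ediam U
  diam_le : ∀ U ∈ 𝓤, Metric.ediam U ≤ ENNReal.ofReal δ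

/-- The upper `Φ`-intermediate dimension of `F`, with the convention `inf ∅ = ∞`. -/
noncomputable def upperIntermediateDim {X : Type*} [MetricSpace X] (Φ : ℝ → ℝ) (F : Set X) :
    ℝ≥0∞ :=
  ⨅ (s : ℝ≥0) (_ : ∀ ε : ℝ, 0 < ε → ∃ δ₀ ∈ Ioc (0 : ℝ) 1, ∀ δ ∈ Ioo 0 δ₀,
      ∃ 𝓤 : Set (Set X), IsScaleCover Φ δ F 𝓤 ∧
        ∑' U : 𝓤, Metric.ediam (U : Set X) ^ (s : ℝ) ≤ ENNReal.ofReal ε),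
    (s : ℝ≥0∞)

/-- The lower `Φ`-intermediate dimension of `F`, with the convention `inf ∅ = ∞`. -/
noncomputable def lowerIntermediateDim {X : Type*} [MetricSpace X] (Φ : ℝ → ℝ) (F : Set X) :
    ℝ≥0∞ :=
  ⨅ (s : ℝ≥0) (_ : ∀ ε : ℝ, 0 < ε → ∀ δ₀ ∈ Ioc (0 : ℝ) 1, ∃ δ ∈ Ioo 0 δ₀,
      ∃ 𝓤 : Set (Set X), IsScaleCover Φ δ F 𝓤 ∧
        ∑' U : 𝓤, Metric.ediam (U : Set X) ^ (s : ℝ) ≤ ENNReal.ofReal ε),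
    (s : ℝ≥0∞)

/-- `μ` is a Borel probability measure which has a support (that is, the set `supp μ` of points
all of whose neighbourhoods have positive mass carries all the mass; this is automatic when `X`
is separable) and whose support is contained in `F`. -/
structure IsProbabilitySupportedOn {X : Type*} [MetricSpace X] [MeasurableSpace X]
    (μ : Measure X) (F : Set X) : Prop where
  isProbabilityMeasure : IsProbabilityMeasure μ
  support_full : μ μ.support = 1
  support_subset : μ.support ⊆ F

/-- `μ(U) ≤ C |U|^s` for every Borel set `U` with `Φ(δ) ≤ |U| ≤ δ`. -/
def HasScaleMassBound {X : Type*} [MetricSpace X] [MeasurableSpace X]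
    (Φ : ℝ → ℝ) (δ C s : ℝ) (μ : Measure X) : Prop :=
  ∀ U : Set X, MeasurableSet U → ENNReal.ofReal (Φ δ) ≤ Metric.ediam U →
    Metric.ediam U ≤ ENNReal.ofReal δ → μ U ≤ ENNReal.ofReal C * Metric.ediam U ^ s

/-!
One inequality is the mass distribution principle: if `μ` is a probability measure on `F` with
`μ U ≤ C |U| ^ s` at the relevant scales, then `∑ |U| ^ s ≥ 1 / C` for every `(Φ, δ)`-cover of `F`
(`one_le_mul_tsum_of_hasScaleMassBound`; the covering sets need not be Borel, but their closures
are, and have the same diameters).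

The other is a Frostman lemma at a single scale `δ`, with constants independent of `δ`
(`exists_measure_of_le_tsum`). Take a finite `Φ δ`-net `E` of `F` and put a weight on `E` that is
maximal among those giving mass at most `ρ ^ s` to each ball of radius `ρ = 2 ^ k * Φ δ` with
centre in `E`, up to a small multiple of `δ`. By maximality every point of `E` lies in a ball on
which the bound is attained. A Vitali subfamily of these saturated balls is disjoint, so that the
sum of its `ρ ^ s` is at most the total mass, and its enlargements cover `F`; uniform perfectness
makes the enlarged balls admissible in a `(Φ, δ)`-cover. If all `(Φ, δ)`-covers have
`∑ |U| ^ s ≥ ε`, the total mass is therefore bounded below by a multiple of `ε`, and the normalised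
weight is the required measure. Sets of diameter comparable to `δ` are handled by covering them
with boundedly many smaller ones, which is where the finite Assouad dimension enters.
-/

/-! ### Weights on finite sets -/

/-- A non-negative weight on a finite set that satisfies finitely many capacity constraints and is
maximal, in the sense that every point lies in a set whose constraint is attained. -/
lemma exists_saturated_weight {X ι : Type*} (E : Finset X) (I : Finset ι) (A : ι → Set X)
    (g : ι → ℝ) (hg : ∀ i ∈ I, 0 ≤ g i) (hcov : ∀ x ∈ E, ∃ i ∈ I, x ∈ A i) :
    ∃ w : X → ℝ, (∀ x, 0 ≤ w x) ∧ (∀ i ∈ I, ∑ x ∈ E, (A i).indicator w x ≤ g i) ∧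
      ∀ x ∈ E, ∃ i ∈ I, x ∈ A i ∧ ∑ y ∈ E, (A i).indicator w y = g i := by
  classical
  induction E using Finset.induction_on with
  | empty => exact ⟨0, by simp, by simpa using hg, by simp⟩
  | insert a E ha ih =>
    obtain ⟨w, hw0, hwg, hws⟩ := ih fun x hx => hcov x (Finset.mem_insert_of_mem hx)
    have hne : (I.filter fun i => a ∈ A i).Nonempty := by
      obtain ⟨i, hi, hai⟩ := hcov a (Finset.mem_insert_self _ _)
      exact ⟨i, by simp [hi, hai]⟩
    -- The new point receives the largest mass that the remaining capacities allow.
    obtain ⟨j, hj, hmin⟩ := Finset.exists_min_image _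
      (fun i => g i - ∑ x ∈ E, (A i).indicator w x) hne
    simp only [Finset.mem_filter, and_imp] at hj hmin
    set v := g j - ∑ x ∈ E, (A j).indicator w x with hv
    have hv0 : 0 ≤ v := sub_nonneg.2 (hwg j hj.1)
    have hsum : ∀ i, ∑ x ∈ insert a E, (A i).indicator (Function.update w a v) x =
        (if a ∈ A i then v else 0) + ∑ x ∈ E, (A i).indicator w x := by
      intro i
      rw [Finset.sum_insert ha]
      congr 1
      · simp [indicator_apply]
      · refine Finset.sum_congr rfl fun x hx => ?_
        have : x ≠ a := fun h => ha (h ▸ hx)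
        simp [indicator_apply, this]
    have hle : ∀ i ∈ I, ∑ x ∈ insert a E, (A i).indicator (Function.update w a v) x ≤ g i := by
      intro i hi
      rw [hsum]
      split_ifs with h
      · linarith [hmin i hi h]
      · linarith [hwg i hi]
    refine ⟨Function.update w a v, fun x => ?_, hle, fun x hx => ?_⟩
    · by_cases h : x = a
      · simpa [h] using hv0
      · simpa [h] using hw0 x
    · rcases Finset.mem_insert.1 hx with rfl | hx
      · exact ⟨j, hj.1, hj.2, by rw [hsum, if_pos hj.2]; linarith⟩
      · obtain ⟨i, hi, hxi, hs⟩ := hws x hx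
        refine ⟨i, hi, hxi, le_antisymm (hle i hi) ?_⟩
        rw [hsum, hs]
        split_ifs <;> linarith

lemma sum_indicator_le_sum_indicator {X : Type*} {E : Finset X} {w : X → ℝ} (hw : ∀ x, 0 ≤ w x)
    {U V : Set X} (h : ∀ x ∈ E, x ∈ U → x ∈ V) :
    ∑ x ∈ E, U.indicator w x ≤ ∑ x ∈ E, V.indicator w x := by
  classical
  refine Finset.sum_le_sum fun x hx => ?_
  simp only [indicator_apply]
  split_ifs with h1 h2 h2
  exacts [le_rfl, absurd (h x hx h1) h2, hw x, le_rfl]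

lemma sum_indicator_le_sum_of_subset_sUnion {X : Type*} {E : Finset X} {w : X → ℝ}
    (hw : ∀ x, 0 ≤ w x) {U : Set X} {𝓑 : Finset (Set X)}
    (h : ∀ x ∈ E, x ∈ U → ∃ B ∈ 𝓑, x ∈ B) :
    ∑ x ∈ E, U.indicator w x ≤ ∑ B ∈ 𝓑, ∑ x ∈ E, B.indicator w x := by
  classical
  rw [Finset.sum_comm]
  refine Finset.sum_le_sum fun x hx => ?_
  have h0 : ∀ B ∈ 𝓑, 0 ≤ B.indicator w x := fun B _ => indicator_nonneg (fun y _ => hw y) x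
  by_cases hU : x ∈ U
  · obtain ⟨B, hB, hxB⟩ := h x hx hU
    rw [indicator_of_mem hU, ← indicator_of_mem hxB w]
    exact Finset.single_le_sum h0 hB
  · rw [indicator_of_notMem hU]
    exact Finset.sum_nonneg h0

lemma sum_sum_indicator_le_of_pairwiseDisjoint {X ι : Type*} {E : Finset X} {w : X → ℝ}
    (hw : ∀ x, 0 ≤ w x) {u : Finset ι} {A : ι → Set X} (h : (u : Set ι).PairwiseDisjoint A) :
    ∑ i ∈ u, ∑ x ∈ E, (A i).indicator w x ≤ ∑ x ∈ E, w x := by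
  classical
  rw [Finset.sum_comm]
  refine Finset.sum_le_sum fun x _ => ?_
  by_cases hx : ∃ i ∈ u, x ∈ A i
  · obtain ⟨i, hi, hxi⟩ := hx
    rw [Finset.sum_eq_single_of_mem i hi, indicator_of_mem hxi]
    intro j hj hji
    exact indicator_of_notMem (fun hxj => disjoint_left.1 (h hj hi hji) hxj hxi) _
  · push Not at hx
    rw [Finset.sum_eq_zero fun i hi => indicator_of_notMem (hx i hi) _]
    exact hw x

/-- The combinatorial core of the Frostman construction. Every point of `E` lies in a ball on which
a maximal weight is saturated; by the Vitali covering lemma a disjoint family `u` of such balls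
covers `E` after enlargement, and disjointness bounds the sum over `u` by the total mass. -/
lemma exists_weight_and_balls {X : Type*} [MetricSpace X] (E : Finset X) {r : ℝ} (hr : 0 < r)
    (n : ℕ) (s : ℝ) :
    ∃ w : X → ℝ, (∀ x, 0 ≤ w x) ∧
      (∀ x ∈ E, ∀ k ≤ n, ∑ y ∈ E, (Metric.closedBall x (2 ^ k * r)).indicator w y ≤
        (2 ^ k * r) ^ s) ∧
      ∃ u : Finset (X × ℕ), (∀ p ∈ u, p.1 ∈ E ∧ p.2 ≤ n) ∧
        ∑ p ∈ u, (2 ^ p.2 * r) ^ s ≤ ∑ x ∈ E, w x ∧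
        ∀ x ∈ E, ∃ p ∈ u, dist x p.1 ≤ 5 * (2 ^ p.2 * r) := by
  classical
  have hpos : ∀ k : ℕ, 0 < 2 ^ k * r := fun k => by positivity
  let I := E ×ˢ Finset.range (n + 1)
  let A : X × ℕ → Set X := fun p => Metric.closedBall p.1 (2 ^ p.2 * r)
  obtain ⟨w, hw0, hwg, hws⟩ := exists_saturated_weight E I A (fun p => (2 ^ p.2 * r) ^ s)
    (fun p _ => (Real.rpow_pos_of_pos (hpos _) _).le)
    (fun x hx => ⟨(x, 0), by simp [I, hx], Metric.mem_closedBall_self (hpos 0).le⟩)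
  refine ⟨w, hw0, fun x hx k hk => hwg (x, k) (by simp [I, hx]; omega), ?_⟩
  let T : Set (X × ℕ) := {p | p ∈ I ∧ ∑ y ∈ E, (A p).indicator w y = (2 ^ p.2 * r) ^ s}
  obtain ⟨v, hvT, hdisj, hv⟩ := Vitali.exists_disjoint_subfamily_covering_enlargement_closedBall T
    (fun p => p.1) (fun p => 2 ^ p.2 * r) (2 ^ n * r) (by
      intro p hp
      have : p.2 ≤ n := by
        have := hp.1
        simp only [I, Finset.mem_product, Finset.mem_range] at this
        omega
      exact mul_le_mul_of_nonneg_right (pow_le_pow_right₀ one_le_two this) hr.le) 5 (by norm_num)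
  have hfin : v.Finite := I.finite_toSet.subset fun p hp => (hvT hp).1
  refine ⟨hfin.toFinset, fun p hp => ?_, ?_, fun x hx => ?_⟩
  · have := (hvT (hfin.mem_toFinset.1 hp)).1
    simp only [I, Finset.mem_product, Finset.mem_range] at this
    exact ⟨this.1, by omega⟩
  · calc ∑ p ∈ hfin.toFinset, (2 ^ p.2 * r) ^ s
        = ∑ p ∈ hfin.toFinset, ∑ y ∈ E, (A p).indicator w y :=
          Finset.sum_congr rfl fun p hp => ((hvT (hfin.mem_toFinset.1 hp)).2).symm
      _ ≤ _ := sum_sum_indicator_le_of_pairwiseDisjoint hw0 (by simpa using hdisj)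
  · obtain ⟨p, hp, hxp, hs⟩ := hws x hx
    obtain ⟨q, hq, hpq⟩ := hv p ⟨hp, hs⟩
    exact ⟨q, hfin.mem_toFinset.2 hq, Metric.mem_closedBall.1 (hpq hxp)⟩

/-! ### Uniform perfectness and Assouad dimension -/

lemma le_ediam_closedBall_of_diff_nonempty {X : Type*} [MetricSpace X] {x : X} {R ρ : ℝ}
    (hR : 0 < R) (h : (Metric.ball x R \ Metric.ball x ρ).Nonempty) :
    ENNReal.ofReal ρ ≤ Metric.ediam (Metric.closedBall x R) := by
  obtain ⟨y, hy, hy'⟩ := h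
  rw [Metric.mem_ball, not_lt] at hy'
  calc ENNReal.ofReal ρ ≤ ENNReal.ofReal (dist y x) := ENNReal.ofReal_le_ofReal hy'
    _ = edist y x := (edist_dist _ _).symm
    _ ≤ _ := Metric.edist_le_ediam_of_mem (Metric.ball_subset_closedBall hy)
      (Metric.mem_closedBall_self hR.le)

/-- At a fixed ratio `K` of scales, finite Assouad dimension bounds covering numbers uniformly in
the centre and the scale. -/
lemma exists_cover_of_assouadDim_lt_top {X : Type*} [MetricSpace X] {F : Set X}
    (hA : assouadDim F < ⊤) {K : ℝ} (hK : 1 < K) :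
    ∃ N : ℕ, ∀ x ∈ F, ∀ η : ℝ, 0 < η → ∃ 𝓑 : Finset (Set X), 𝓑.card ≤ N ∧
      (∀ B ∈ 𝓑, Metric.ediam B ≤ ENNReal.ofReal η) ∧
      ∀ y ∈ F, dist y x < K * η → ∃ B ∈ 𝓑, y ∈ B := by
  unfold assouadDim at hA
  simp only [iInf_lt_iff] at hA
  obtain ⟨α, ⟨C, hC, h⟩, -⟩ := hA
  refine ⟨⌈C * K ^ α⌉₊, fun x hx η hη => ?_⟩
  have h1 := h x hx η (K * η) hη (by nlinarith)
  rw [mul_div_cancel_right₀ _ hη.ne'] at h1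
  have h2 : ballCoveringNumber η (Metric.ball x (K * η) ∩ F) < ((⌈C * K ^ α⌉₊ + 1 : ℕ) : ℕ∞) := by
    have h3 : ENNReal.ofReal (C * K ^ α) < ((⌈C * K ^ α⌉₊ + 1 : ℕ) : ℝ≥0∞) := by
      rw [← ENNReal.ofReal_natCast]
      refine ENNReal.ofReal_lt_ofReal_iff_of_nonneg (by positivity) |>.2 ?_
      push_cast
      linarith [Nat.le_ceil (C * K ^ α)]
    have := h1.trans_lt h3
    exact_mod_cast this
  unfold ballCoveringNumber at h2
  simp only [iInf_lt_iff] at h2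
  obtain ⟨𝓑, ⟨h𝓑, hcov⟩, hcard⟩ := h2
  have hfin : 𝓑.Finite := Set.encard_lt_top_iff.1 (hcard.trans (ENat.natCast_lt_top _))
  refine ⟨hfin.toFinset, ?_, fun B hB => (h𝓑 B (hfin.mem_toFinset.1 hB)).2, fun y hy hyx => ?_⟩
  · rw [hfin.encard_eq_coe_toFinset_card] at hcard
    have := Nat.cast_lt.1 hcard
    omega
  · obtain ⟨B, hB, hyB⟩ := hcov ⟨hyx, hy⟩
    exact ⟨B, hfin.mem_toFinset.2 hB, hyB⟩

/-! ### Finitely supported measures -/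

lemma IsProbabilitySupportedOn.mono {X : Type*} [MetricSpace X] [MeasurableSpace X]
    {μ : Measure X} {F G : Set X} (h : IsProbabilitySupportedOn μ F) (hFG : F ⊆ G) :
    IsProbabilitySupportedOn μ G :=
  ⟨h.1, h.2, h.3.trans hFG⟩

lemma exists_measure_of_weight {X : Type*} [MetricSpace X] [MeasurableSpace X] [BorelSpace X]
    (E : Finset X) {w : X → ℝ} (hw : ∀ x, 0 ≤ w x) (hW : 0 < ∑ x ∈ E, w x) :
    ∃ μ : Measure X, IsProbabilitySupportedOn μ (E : Set X) ∧ ∀ U, MeasurableSet U →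
      μ U = ENNReal.ofReal ((∑ x ∈ E, U.indicator w x) / ∑ x ∈ E, w x) := by
  classical
  set W := ∑ x ∈ E, w x
  let μ : Measure X := ∑ x ∈ E, ENNReal.ofReal (w x / W) • Measure.dirac x
  have hμ : ∀ U, MeasurableSet U → μ U = ENNReal.ofReal ((∑ x ∈ E, U.indicator w x) / W) := by
    intro U hU
    rw [Finset.sum_div, ENNReal.ofReal_sum_of_nonneg fun x _ =>
      div_nonneg (indicator_nonneg (fun y _ => hw y) x) hW.le]
    simp only [μ, Measure.coe_finsetSum, Finset.sum_apply, Measure.smul_apply, smul_eq_mul,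
      Measure.dirac_apply' _ hU]
    refine Finset.sum_congr rfl fun x _ => ?_
    by_cases h : x ∈ U <;> simp [h]
  have hEc : μ (E : Set X)ᶜ = 0 := by
    rw [hμ _ E.measurableSet.compl, Finset.sum_eq_zero]
    · simp
    · exact fun x hx => indicator_of_notMem (by simpa using hx) _
  have hprob : IsProbabilityMeasure μ := ⟨by
    rw [hμ _ MeasurableSet.univ]
    simp only [indicator_univ]
    rw [div_self hW.ne', ENNReal.ofReal_one]⟩
  have hsupp : μ μ.supportᶜ = 0 := by
    have hnull : μ ((E : Set X) ∩ μ.supportᶜ) = 0 := by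
      refine (measure_null_iff_singleton (E.finite_toSet.inter_of_left _).countable).2 ?_
      rintro x ⟨-, hx⟩
      obtain ⟨U, hU, hU0⟩ := Measure.notMem_support_iff_exists.1 hx
      exact measure_mono_null (singleton_subset_iff.2 (mem_of_mem_nhds hU)) hU0
    refine measure_mono_null (fun x hx => ?_) (measure_union_null hnull hEc)
    by_cases h : x ∈ (E : Set X)
    exacts [Or.inl ⟨h, hx⟩, Or.inr h]
  refine ⟨μ, ⟨hprob, ?_, ?_⟩, hμ⟩
  · exact (prob_compl_eq_zero_iff Measure.isClosed_support.measurableSet).1 hsupp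
  · intro x hx
    by_contra hxE
    exact (Measure.mem_support_iff_forall x).1 hx _
      (E.finite_toSet.isClosed.isOpen_compl.mem_nhds hxE) |>.ne' hEc

/-! ### The mass distribution principle -/

/-- A mass bound for a measure on `F` bounds the sums of all `(Φ, δ)`-covers from below. -/
lemma one_le_mul_tsum_of_hasScaleMassBound {X : Type*} [MetricSpace X] [MeasurableSpace X]
    [BorelSpace X] {Φ : ℝ → ℝ} {δ C s : ℝ} {F : Set X} {μ : Measure X} {𝓤 : Set (Set X)}
    (hμ : IsProbabilitySupportedOn μ F) (hb : HasScaleMassBound Φ δ C s μ)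
    (h𝓤 : IsScaleCover Φ δ F 𝓤) :
    1 ≤ ENNReal.ofReal C * ∑' U : 𝓤, Metric.ediam (U : Set X) ^ s := by
  have := h𝓤.countable.to_subtype
  calc (1 : ℝ≥0∞) = μ μ.support := hμ.support_full.symm
    _ ≤ μ (⋃ U : 𝓤, closure (U : Set X)) := by
      refine measure_mono fun x hx => ?_
      obtain ⟨U, hU, hxU⟩ := h𝓤.covers (hμ.support_subset hx)
      exact mem_iUnion.2 ⟨⟨U, hU⟩, subset_closure hxU⟩
    _ ≤ ∑' U : 𝓤, μ (closure (U : Set X)) := measure_iUnion_le _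
    _ ≤ ∑' U : 𝓤, ENNReal.ofReal C * Metric.ediam (U : Set X) ^ s := by
      refine ENNReal.tsum_le_tsum fun U => ?_
      have := hb (closure U) isClosed_closure.measurableSet
      rw [Metric.ediam_closure] at this
      exact this (h𝓤.le_diam U U.2) (h𝓤.diam_le U U.2)
    _ = _ := ENNReal.tsum_mul_left

/-- If mass bounds with exponent `s` and covers with arbitrarily small `t`-sums occur at common
scales `δ ≤ 1`, then `s ≤ t`. The bound `δ ≤ 1` makes `|U| ^ s` decreasing in `s`. -/
lemma le_of_scaleMassBound_of_covers {X : Type*} [MetricSpace X] [MeasurableSpace X] [BorelSpace X]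
    {Φ : ℝ → ℝ} {F : Set X} {C : ℝ} (hC : 0 < C) {s t : ℝ≥0}
    (h : ∀ ε : ℝ, 0 < ε → ∃ δ ≤ 1, (∃ μ : Measure X, IsProbabilitySupportedOn μ F ∧
      HasScaleMassBound Φ δ C s μ) ∧ ∃ 𝓤 : Set (Set X), IsScaleCover Φ δ F 𝓤 ∧
        ∑' U : 𝓤, Metric.ediam (U : Set X) ^ (t : ℝ) ≤ ENNReal.ofReal ε) :
    s ≤ t := by
  by_contra! hts
  obtain ⟨δ, hδ, ⟨μ, hμ, hb⟩, 𝓤, h𝓤, hsum⟩ := h (1 / (2 * C)) (by positivity)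
  have h1 := one_le_mul_tsum_of_hasScaleMassBound hμ hb h𝓤
  have h2 : ∑' U : 𝓤, Metric.ediam (U : Set X) ^ (s : ℝ) ≤
      ∑' U : 𝓤, Metric.ediam (U : Set X) ^ (t : ℝ) := by
    refine ENNReal.tsum_le_tsum fun U => ?_
    refine ENNReal.rpow_le_rpow_of_exponent_ge ?_ (by exact_mod_cast hts.le)
    exact (h𝓤.diam_le U U.2).trans (ENNReal.ofReal_le_one.2 hδ)
  have h3 : (1 : ℝ≥0∞) ≤ ENNReal.ofReal C * ENNReal.ofReal (1 / (2 * C)) :=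
    h1.trans (mul_le_mul_right (h2.trans hsum) _)
  rw [← ENNReal.ofReal_mul hC.le, ENNReal.one_le_ofReal] at h3
  have h4 : C * (1 / (2 * C)) = 1 / 2 := by field_simp
  linarith

/-! ### The Frostman construction -/

/-- The Frostman construction at a fixed scale `δ`, with a constant independent of `δ`. Here `c` is
a constant of uniform perfectness and `6 / c` the enlargement factor of the saturated balls: the
factor `6` makes them cover `F`, and `1 / c` makes their diameters at least `Φ δ`. The number `N`
is a covering number coming from the Assouad dimension; it serves the scales that are so close
to `δ` that enlarged balls would be too large. -/
lemma exists_measure_of_le_tsum {X : Type*} [MetricSpace X] [MeasurableSpace X] [BorelSpace X]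
    {c : ℝ} (hc : c ∈ Ioo (0 : ℝ) 1)
    (hX : ∀ (x : X) (R : ℝ), 0 < R → ENNReal.ofReal R < Metric.ediam (univ : Set X) →
      (Metric.ball x R \ Metric.ball x (c * R)).Nonempty)
    {F : Set X} (htb : TotallyBounded F) {N : ℕ}
    (hN : ∀ x ∈ F, ∀ η : ℝ, 0 < η → ∃ 𝓑 : Finset (Set X), 𝓑.card ≤ N ∧
      (∀ B ∈ 𝓑, Metric.ediam B ≤ ENNReal.ofReal η) ∧
      ∀ y ∈ F, dist y x < 8 * (6 / c) * η → ∃ B ∈ 𝓑, y ∈ B)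
    {Φ : ℝ → ℝ} {δ : ℝ} (hΦ : 0 < Φ δ) (hΦδ : 2 * (6 / c) * Φ δ ≤ δ)
    (hδX : ENNReal.ofReal δ < Metric.ediam (univ : Set X)) {s : ℝ} (hs : 0 ≤ s)
    {ε : ℝ} (hε : 0 < ε)
    (h : ∀ 𝓤 : Set (Set X), IsScaleCover Φ δ F 𝓤 →
      ENNReal.ofReal ε ≤ ∑' U : 𝓤, Metric.ediam (U : Set X) ^ s) :
    ∃ μ : Measure X, IsProbabilitySupportedOn μ F ∧
      HasScaleMassBound Φ δ ((2 ^ s + N) * ((2 * (6 / c)) ^ s / ε)) s μ := by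
  classical
  obtain ⟨hc0, hc1⟩ := hc
  set L := 6 / c with hL
  have hL6 : 6 ≤ L := by rw [hL, le_div_iff₀ hc0]; linarith
  have hcL : c * L = 6 := by rw [hL]; field_simp
  clear_value L
  set r := Φ δ with hr
  have hδ : 0 < δ := lt_of_lt_of_le (by positivity) hΦδ
  -- The largest scale `2 ^ n * r` at which enlarged balls have diameter at most `δ`.
  obtain ⟨n, hn, hn'⟩ := exists_nat_pow_near (x := δ / (2 * L * r)) (y := 2)
    (by rw [le_div_iff₀ (by positivity)]; linarith) one_lt_two
  rw [le_div_iff₀ (by positivity)] at hn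
  rw [div_lt_iff₀ (by positivity), pow_succ] at hn'
  obtain ⟨E', hEF, hE'fin, hEcov⟩ := Metric.finite_approx_of_totallyBounded htb r hΦ
  lift E' to Finset X using hE'fin
  rename' E' => E
  obtain ⟨w, hw0, hwb, u, hu, hsum, hcov⟩ := exists_weight_and_balls E hΦ n s
  have hρ : ∀ k : ℕ, r ≤ 2 ^ k * r := fun k =>
    le_mul_of_one_le_left hΦ.le (one_le_pow₀ one_le_two)
  have hρn : ∀ k ≤ n, 2 * L * (2 ^ k * r) ≤ δ := by
    intro k hk
    have h1 : (2 : ℝ) ^ k ≤ 2 ^ n := pow_le_pow_right₀ one_le_two hk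
    have h2 : (2 : ℝ) ^ k * (2 * L * r) ≤ 2 ^ n * (2 * L * r) :=
      mul_le_mul_of_nonneg_right h1 (by positivity)
    linarith
  set W := ∑ x ∈ E, w x with hW
  -- The enlarged balls form a `(Φ, δ)`-cover, which bounds the total mass from below.
  let V : X × ℕ → Set X := fun p => Metric.closedBall p.1 (L * (2 ^ p.2 * r))
  have hVle : ∀ p, Metric.ediam (V p) ≤ ENNReal.ofReal (2 * L * (2 ^ p.2 * r)) := by
    intro p
    refine Metric.ediam_le_of_forall_dist_le fun x hx y hy => ?_
    have := dist_triangle_right x y p.1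
    rw [Metric.mem_closedBall] at hx hy
    linarith
  have hcover : IsScaleCover Φ δ F (V '' (u : Set (X × ℕ))) := by
    refine ⟨(u.finite_toSet.image V).countable, fun x hx => ?_, ?_, ?_⟩
    · obtain ⟨y, hy, hxy⟩ := mem_iUnion₂.1 (hEcov hx)
      obtain ⟨p, hp, hyp⟩ := hcov y hy
      refine ⟨V p, mem_image_of_mem V hp, ?_⟩
      rw [Metric.mem_ball] at hxy
      have := dist_triangle x y p.1
      have := hρ p.2
      rw [Metric.mem_closedBall]
      nlinarith
    · rintro _ ⟨p, hp, rfl⟩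
      have hR : 0 < L * (2 ^ p.2 * r) := by positivity
      have h1 := le_ediam_closedBall_of_diff_nonempty hR (hX p.1 _ hR
        ((ENNReal.ofReal_le_ofReal (by linarith [hρn p.2 (hu p hp).2])).trans_lt hδX))
      refine le_trans (ENNReal.ofReal_le_ofReal ?_) h1
      rw [← mul_assoc, hcL]
      linarith [hρ p.2]
    · rintro _ ⟨p, hp, rfl⟩
      exact (hVle p).trans (ENNReal.ofReal_le_ofReal (hρn p.2 (hu p hp).2))
  have hεW : ε ≤ (2 * L) ^ s * W := by
    have h1 : ENNReal.ofReal ε ≤ ENNReal.ofReal ((2 * L) ^ s * W) := by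
      calc ENNReal.ofReal ε
          ≤ ∑' U : V '' (u : Set (X × ℕ)), Metric.ediam (U : Set X) ^ s := h _ hcover
        _ ≤ ∑' p : (u : Set (X × ℕ)), Metric.ediam (V p) ^ s :=
          ENNReal.tsum_le_tsum_comp_of_surjective
            (f := fun p : (u : Set (X × ℕ)) => (⟨V p, mem_image_of_mem V p.2⟩ :
              V '' (u : Set (X × ℕ))))
            (by rintro ⟨_, p, hp, rfl⟩; exact ⟨⟨p, hp⟩, rfl⟩) _
        _ = ∑ p ∈ u, Metric.ediam (V p) ^ s :=
          Finset.tsum_subtype' u fun p => Metric.ediam (V p) ^ s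
        _ ≤ ∑ p ∈ u, ENNReal.ofReal ((2 * L) ^ s * (2 ^ p.2 * r) ^ s) := by
          refine Finset.sum_le_sum fun p _ => ?_
          rw [← Real.mul_rpow (by positivity) (by positivity),
            ← ENNReal.ofReal_rpow_of_nonneg (by positivity) hs]
          exact ENNReal.rpow_le_rpow (hVle p) hs
        _ = ENNReal.ofReal ((2 * L) ^ s * ∑ p ∈ u, (2 ^ p.2 * r) ^ s) := by
          rw [Finset.mul_sum, ENNReal.ofReal_sum_of_nonneg fun p _ => by positivity]
        _ ≤ _ := ENNReal.ofReal_le_ofReal (mul_le_mul_of_nonneg_left hsum (by positivity))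
    by_contra! hlt
    exact absurd h1 (not_le.2 ((ENNReal.ofReal_lt_ofReal_iff hε).2 hlt))
  have hWpos : 0 < W := pos_of_mul_pos_right (hε.trans_le hεW) (by positivity)
  obtain ⟨μ, hμE, hμ⟩ := exists_measure_of_weight E hw0 hWpos
  refine ⟨μ, hμE.mono hEF, fun U hU hUr hUδ => ?_⟩
  rw [hμ U hU]
  have hUtop : Metric.ediam U ≠ ⊤ := ne_top_of_le_ne_top ENNReal.ofReal_ne_top hUδ
  obtain ⟨d, hd0, hd⟩ : ∃ d : ℝ, 0 ≤ d ∧ Metric.ediam U = ENNReal.ofReal d :=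
    ⟨_, ENNReal.toReal_nonneg, (ENNReal.ofReal_toReal hUtop).symm⟩
  rw [hd] at hUr hUδ ⊢
  rw [ENNReal.ofReal_le_ofReal_iff hd0] at hUr
  rw [ENNReal.ofReal_le_ofReal_iff hδ.le] at hUδ
  have hdist : ∀ {S : Set X} {a : ℝ}, 0 ≤ a → Metric.ediam S ≤ ENNReal.ofReal a →
      ∀ x ∈ S, ∀ y ∈ S, dist x y ≤ a := by
    intro S a ha hS x hx y hy
    have := Metric.edist_le_of_ediam_le hx hy hS
    rwa [edist_dist, ENNReal.ofReal_le_ofReal_iff ha] at this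
  have hmass : ∑ x ∈ E, U.indicator w x ≤ (2 ^ s + N) * d ^ s := by
    have hds : 0 ≤ d ^ s := Real.rpow_nonneg hd0 s
    by_cases hne : ∃ x ∈ E, x ∈ U
    swap
    · push Not at hne
      rw [Finset.sum_eq_zero fun x hx => indicator_of_notMem (hne x hx) _]
      positivity
    obtain ⟨x, hxE, hxU⟩ := hne
    obtain ⟨m, hm, hm'⟩ := exists_nat_pow_near (x := d / r) (y := 2)
      (by rwa [one_le_div hΦ]) one_lt_two
    rw [le_div_iff₀ hΦ] at hm
    rw [div_lt_iff₀ hΦ] at hm'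
    rcases lt_or_ge m n with hmn | hmn
    · -- `U` lies in a ball of comparable radius on which the weight is controlled.
      calc ∑ x ∈ E, U.indicator w x
          ≤ ∑ y ∈ E, (Metric.closedBall x (2 ^ (m + 1) * r)).indicator w y :=
            sum_indicator_le_sum_indicator hw0 fun y _ hy =>
              Metric.mem_closedBall.2 ((hdist hd0 hd.le y hy x hxU).trans hm'.le)
        _ ≤ (2 ^ (m + 1) * r) ^ s := hwb x hxE (m + 1) hmn
        _ ≤ (2 * d) ^ s := by
          refine Real.rpow_le_rpow (by positivity) ?_ hs
          rw [pow_succ]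
          linarith
        _ = 2 ^ s * d ^ s := Real.mul_rpow zero_le_two hd0
        _ ≤ (2 ^ s + N) * d ^ s := by
          refine mul_le_mul_of_nonneg_right ?_ hds
          linarith [Nat.cast_nonneg (α := ℝ) N]
    · -- `U` is so large that boundedly many sets of diameter at most `2 ^ n * r` cover
      -- its points of `F`.
      have hnd : 2 ^ n * r ≤ d :=
        (mul_le_mul_of_nonneg_right (pow_le_pow_right₀ one_le_two hmn) hΦ.le).trans hm
      have hη : 0 < δ / (4 * L) := by positivity
      have hηn : δ / (4 * L) ≤ 2 ^ n * r := by
        rw [div_le_iff₀ (by positivity)]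
        linarith
      obtain ⟨𝓑, hcard, hdiam, h𝓑⟩ := hN x (hEF hxE) (δ / (4 * L)) hη
      have hKη : 8 * L * (δ / (4 * L)) = 2 * δ := by field_simp; norm_num
      calc ∑ x ∈ E, U.indicator w x
          ≤ ∑ B ∈ 𝓑, ∑ y ∈ E, B.indicator w y :=
            sum_indicator_le_sum_of_subset_sUnion hw0 fun y hyE hy => h𝓑 y (hEF hyE) (by
              rw [hKη]
              linarith [hdist hd0 hd.le y hy x hxU])
        _ ≤ ∑ B ∈ 𝓑, d ^ s := by
          refine Finset.sum_le_sum fun B hB => ?_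
          by_cases hBE : ∃ z ∈ E, z ∈ B
          · obtain ⟨z, hzE, hzB⟩ := hBE
            refine (sum_indicator_le_sum_indicator hw0 fun y _ hy => ?_).trans
              ((hwb z hzE n le_rfl).trans (Real.rpow_le_rpow (by positivity) hnd hs))
            exact Metric.mem_closedBall.2 ((hdist hη.le (hdiam B hB) y hy z hzB).trans hηn)
          · push Not at hBE
            rwa [Finset.sum_eq_zero fun x hx => indicator_of_notMem (hBE x hx) _]
        _ = 𝓑.card * d ^ s := by rw [Finset.sum_const, nsmul_eq_mul]
        _ ≤ (2 ^ s + N) * d ^ s := by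
          refine mul_le_mul_of_nonneg_right ?_ hds
          have h1 : (𝓑.card : ℝ) ≤ N := by exact_mod_cast hcard
          linarith [Real.rpow_pos_of_pos (zero_lt_two (α := ℝ)) s]
  rw [ENNReal.ofReal_rpow_of_nonneg hd0 hs, ← ENNReal.ofReal_mul (by positivity)]
  refine ENNReal.ofReal_le_ofReal ?_
  rw [div_le_iff₀ hWpos]
  have h1 : 1 ≤ (2 * L) ^ s / ε * W := by
    rw [div_mul_eq_mul_div, one_le_div hε]
    exact hεW
  calc ∑ x ∈ E, U.indicator w x ≤ (2 ^ s + N) * d ^ s := hmass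
    _ ≤ (2 ^ s + N) * d ^ s * ((2 * L) ^ s / ε * W) :=
      le_mul_of_one_le_right (by positivity) h1
    _ = _ := by ring

/-- The constant `C` and the threshold `δ₁` are chosen before `δ`; the hypothesis on covers is only
needed at the same scale `δ` as the conclusion, which serves both the upper and the lower
dimension. -/
lemma exists_forall_exists_measure {X : Type*} [MetricSpace X] [MeasurableSpace X] [BorelSpace X]
    [Nontrivial X] (hX : IsUniformlyPerfect X) {Φ : ℝ → ℝ} (hΦ : IsAdmissible Φ)
    {F : Set X} (htb : TotallyBounded F) (hA : assouadDim F < ⊤) {s : ℝ} (hs : 0 ≤ s)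
    {ε : ℝ} (hε : 0 < ε) :
    ∃ C δ₁ : ℝ, 0 < C ∧ 0 < δ₁ ∧ ∀ δ ∈ Ioo 0 δ₁,
      (∀ 𝓤 : Set (Set X), IsScaleCover Φ δ F 𝓤 →
        ENNReal.ofReal ε ≤ ∑' U : 𝓤, Metric.ediam (U : Set X) ^ s) →
      ∃ μ : Measure X, IsProbabilitySupportedOn μ F ∧ HasScaleMassBound Φ δ C s μ := by
  obtain ⟨c, hc, hX⟩ := hX
  obtain ⟨Y, hY, hΦ⟩ := hΦ
  have hc0 := hc.1
  have hL6 : 6 ≤ 6 / c := by rw [le_div_iff₀ hc0]; linarith [hc.2]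
  obtain ⟨N, hN⟩ := exists_cover_of_assouadDim_lt_top hA (K := 8 * (6 / c)) (by linarith)
  obtain ⟨x, y, hxy⟩ := exists_pair_ne X
  have hev : ∀ᶠ δ in 𝓝[>] (0 : ℝ), Φ δ / δ < 1 / (2 * (6 / c)) :=
    hΦ.tendsto.eventually_lt_const (by positivity)
  obtain ⟨a, ha, hev⟩ := mem_nhdsGT_iff_exists_Ioo_subset.1 hev
  refine ⟨(2 ^ s + N) * ((2 * (6 / c)) ^ s / ε), min (min Y a) (dist x y), by positivity,
    lt_min (lt_min hY ha) (dist_pos.2 hxy), fun δ hδ h => ?_⟩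
  obtain ⟨hδ0, hδ⟩ := hδ
  simp only [lt_min_iff] at hδ
  refine exists_measure_of_le_tsum hc hX htb hN (hΦ.pos δ ⟨hδ0, hδ.1.1⟩) ?_ ?_ hs hε h
  · have h1 : Φ δ / δ < 1 / (2 * (6 / c)) := hev ⟨hδ0, hδ.1.2⟩
    rw [div_lt_div_iff₀ hδ0 (by positivity)] at h1
    linarith
  · calc ENNReal.ofReal δ < ENNReal.ofReal (dist x y) :=
        (ENNReal.ofReal_lt_ofReal_iff (dist_pos.2 hxy)).2 hδ.2
      _ = edist x y := (edist_dist _ _).symm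
      _ ≤ _ := Metric.edist_le_ediam_of_mem (mem_univ _) (mem_univ _)

theorem theorem5p3 {X : Type*} [MetricSpace X] [MeasurableSpace X] [BorelSpace X] [Nontrivial X]
    (hX : IsUniformlyPerfect X) (Φ : ℝ → ℝ) (hΦ : IsAdmissible Φ)
    (F : Set X) (hne : F.Nonempty) (htb : TotallyBounded F) (hA : assouadDim F < ⊤) :
    (upperIntermediateDim Φ F =
      ⨆ (s : ℝ≥0) (_ : ∃ C : ℝ, 0 < C ∧ ∀ δ₁ : ℝ, 0 < δ₁ → ∃ δ ∈ Ioo 0 δ₁,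
          ∃ μ : Measure X, IsProbabilitySupportedOn μ F ∧ HasScaleMassBound Φ δ C s μ),
        (s : ℝ≥0∞)) ∧
    (lowerIntermediateDim Φ F =
      ⨆ (s : ℝ≥0) (_ : ∃ C δ₁ : ℝ, 0 < C ∧ 0 < δ₁ ∧ ∀ δ ∈ Ioo 0 δ₁,
          ∃ μ : Measure X, IsProbabilitySupportedOn μ F ∧ HasScaleMassBound Φ δ C s μ),
        (s : ℝ≥0∞)) := by
  constructor
  · apply le_antisymm
    · refine ENNReal.le_of_forall_nnreal_lt fun s hs => ?_
      have hs' := mt (fun h => iInf₂_le (f := fun (s : ℝ≥0) _ => (s : ℝ≥0∞)) s h) (not_le.2 hs)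
      push Not at hs'
      obtain ⟨ε, hε, hcov⟩ := hs'
      obtain ⟨C, δ₂, hC, hδ₂, h⟩ :=
        exists_forall_exists_measure hX hΦ htb hA s.coe_nonneg hε
      refine le_iSup₂_of_le s ⟨C, hC, fun δ₁ hδ₁ => ?_⟩ le_rfl
      obtain ⟨δ, hδ, hcov⟩ := hcov (min (min δ₁ δ₂) 1)
        ⟨lt_min (lt_min hδ₁ hδ₂) one_pos, min_le_right _ _⟩
      have hδ' := hδ.2
      simp only [lt_min_iff] at hδ'
      exact ⟨δ, ⟨hδ.1, hδ'.1.1⟩, h δ ⟨hδ.1, hδ'.1.2⟩ fun 𝓤 h𝓤 => (hcov 𝓤 h𝓤).le⟩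
    · refine iSup₂_le fun s ⟨C, hC, h⟩ => le_iInf₂ fun t ht => ?_
      refine ENNReal.coe_le_coe.2 (le_of_scaleMassBound_of_covers (Φ := Φ) (F := F) hC
        fun ε hε => ?_)
      obtain ⟨δ₀, hδ₀, ht⟩ := ht ε hε
      obtain ⟨δ, hδ, h⟩ := h δ₀ hδ₀.1
      exact ⟨δ, hδ.2.le.trans hδ₀.2, h, ht δ hδ⟩
  · apply le_antisymm
    · refine ENNReal.le_of_forall_nnreal_lt fun s hs => ?_
      have hs' := mt (fun h => iInf₂_le (f := fun (s : ℝ≥0) _ => (s : ℝ≥0∞)) s h) (not_le.2 hs)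
      push Not at hs'
      obtain ⟨ε, hε, δ₀, hδ₀, hcov⟩ := hs'
      obtain ⟨C, δ₂, hC, hδ₂, h⟩ :=
        exists_forall_exists_measure hX hΦ htb hA s.coe_nonneg hε
      refine le_iSup₂_of_le s ⟨C, min δ₀ δ₂, hC, lt_min hδ₀.1 hδ₂, fun δ hδ => ?_⟩ le_rfl
      have hδ' := hδ.2
      simp only [lt_min_iff] at hδ'
      exact h δ ⟨hδ.1, hδ'.2⟩ fun 𝓤 h𝓤 => (hcov δ ⟨hδ.1, hδ'.1⟩ 𝓤 h𝓤).le
    · refine iSup₂_le fun s ⟨C, δ₁, hC, hδ₁, h⟩ => le_iInf₂ fun t ht => ?_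
      refine ENNReal.coe_le_coe.2 (le_of_scaleMassBound_of_covers (Φ := Φ) (F := F) hC
        fun ε hε => ?_)
      obtain ⟨δ, hδ, ht⟩ := ht ε hε (min δ₁ 1) ⟨lt_min hδ₁ one_pos, min_le_right _ _⟩
      have hδ' := hδ.2
      simp only [lt_min_iff] at hδ'
      exact ⟨δ, hδ'.2.le, h δ ⟨hδ.1, hδ'.1⟩, ht⟩
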